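/- Let $G=(V,E)$ be a finite, undirected graph without loops or multiple edges. Write $\alpha(G)$ for the maximum cardinality of an independent set of vertices of $G$ and $\mu(G)$ for the maximum cardinality of a matching of $G$. An independent set of cardinality $\alpha(G)$ is called a maximum independent set; let $\mathrm{core}(G)$ be the intersection, and $\mathrm{corona}(G)$ the union, of all maximum independent sets of $G$. The graph $G$ is called a König–Egerváry graph if $\alpha(G)+\mu(G)=|V|$, and it is called unicyclic if it is connected and contains exactly one cycle (as a subgraph). If $G$ is a unicyclic graph, then $$2\alpha(G)\le |\mathrm{corona}(G)|+|\mathrm{core}(G)|\le 2\alpha(G)+1.$$ Moreover, $G$ is a non-König–Egerváry graph if and only if $$|\mathrm{corona}(G)|+|\mathrm{core}(G)|=2\alpha(G)+1.$$ -/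

import Mathlib

namespace SimpleGraph

variable {V : Type*}

/-- The core of a finite graph: the intersection of all its maximum independent sets. -/
def core [Finite V] (G : SimpleGraph V) : Set V :=
  ⋂ S ∈ {S : Finset V | G.IsMaximumIndepSet S}, (S : Set V)

/-- The corona of a finite graph: the union of all its maximum independent sets. -/
def corona [Finite V] (G : SimpleGraph V) : Set V :=
  ⋃ S ∈ {S : Finset V | G.IsMaximumIndepSet S}, (S : Set V)

/-- The matching number: the largest number of edges in a matching (a set of pairwise
non-incident edges) of a finite graph. -/
noncomputable def matchingNum (G : SimpleGraph V) : ℕ :=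
  sSup {n | ∃ M : G.Subgraph, M.IsMatching ∧ M.edgeSet.ncard = n}

/-- A finite graph is a König–Egerváry graph if the sum of its independence number and its
matching number is its order. -/
def IsKonigEgervary (G : SimpleGraph V) : Prop :=
  G.indepNum + G.matchingNum = Nat.card V

/-- A subgraph is a cycle if it is traced out by some closed walk that is a cycle. -/
def Subgraph.IsCycleSubgraph {G : SimpleGraph V} (C : G.Subgraph) : Prop :=
  ∃ (u : V) (p : G.Walk u u), p.IsCycle ∧ p.toSubgraph = C

/-- A graph is unicyclic if it is connected and has a unique cycle, where cycles are counted as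
subgraphs, that is, regardless of starting vertex and orientation. -/
def IsUnicyclic (G : SimpleGraph V) : Prop :=
  G.Connected ∧ ∃! C : G.Subgraph, C.IsCycleSubgraph

end SimpleGraph

/-! For every finite graph with at most one cycle, the defects |corona| + |core| − 2α and |V| − α −
μ agree, and their common value is 0 or 1. This gives both claims. `CoreCoronaBalanced` states it
for the subgraph induced on a vertex set A, without subtraction and with a matching measured by the
2μ vertices it covers. Connectivity is dropped so that the hypothesis passes to induced subgraphs,
which allows strong induction on A.

Deleting an isolated vertex, or a pendant vertex together with its neighbour, changes neither defect
(`CoreCoronaBalanced.of_isolated`, `CoreCoronaBalanced.of_pendant`). If A is nonempty and has no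
such vertex, all degrees are at least 2. At most one cycle means at most as many edges as vertices,
so the graph is 2-regular, hence a union of cycles, hence a single cycle on n vertices. There the
corona is everything, the core is empty and α = μ = ⌊n/2⌋, so both defects equal n mod 2
(`CoreCoronaBalanced.of_cycle`). -/

namespace SimpleGraph

/-! ### Independence and matching invariants of induced subgraphs. -/

open scoped Classical in
/-- The independence number of the subgraph induced on `A`. -/
noncomputable def alphaOn {V : Type*} (G : SimpleGraph V) (A : Finset V) : ℕ :=
  (A.powerset.filter fun S : Finset V => G.IsIndepSet (S : Set V)).sup Finset.card

/-- `S` is a maximum independent set of the subgraph induced on `A`. -/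
structure IsMaxIndepOn {V : Type*} (G : SimpleGraph V) (A S : Finset V) : Prop where
  subset : S ⊆ A
  indep : G.IsIndepSet (S : Set V)
  card_eq : S.card = G.alphaOn A

open scoped Classical in
/-- The corona of the subgraph induced on `A`. -/
noncomputable def coronaOn {V : Type*} (G : SimpleGraph V) (A : Finset V) : Finset V :=
  A.filter fun x => ∃ S, G.IsMaxIndepOn A S ∧ x ∈ S

open scoped Classical in
/-- The core of the subgraph induced on `A`. -/
noncomputable def coreOn {V : Type*} (G : SimpleGraph V) (A : Finset V) : Finset V :=
  A.filter fun x => ∀ S, G.IsMaxIndepOn A S → x ∈ S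

/-- The vertices of `T` can be perfectly matched among themselves. -/
def Matchable {V : Type*} (G : SimpleGraph V) (T : Finset V) : Prop :=
  ∃ f : V → V, ∀ x ∈ T, f x ∈ T ∧ f (f x) = x ∧ G.Adj x (f x)

open scoped Classical in
/-- The largest number of vertices of `A` covered by a matching of the subgraph induced on `A`. -/
noncomputable def matchedOn {V : Type*} (G : SimpleGraph V) (A : Finset V) : ℕ :=
  (A.powerset.filter fun T => G.Matchable T).sup Finset.card

variable {V : Type*} {G : SimpleGraph V} {A S T : Finset V} {u v x : V}

lemma IsIndepSet.card_le_alphaOn (hS : G.IsIndepSet (S : Set V)) (hSA : S ⊆ A) :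
    S.card ≤ G.alphaOn A := by
  classical
  exact Finset.le_sup (f := Finset.card) (by simp [hS, hSA])

lemma exists_isMaxIndepOn (G : SimpleGraph V) (A : Finset V) : ∃ S, G.IsMaxIndepOn A S := by
  classical
  obtain ⟨S, hS, h⟩ := Finset.exists_mem_eq_sup
    (A.powerset.filter fun S : Finset V => G.IsIndepSet (S : Set V)) ⟨∅, by simp⟩ Finset.card
  simp only [Finset.mem_filter, Finset.mem_powerset] at hS
  exact ⟨S, hS.1, hS.2, h.symm⟩

lemma alphaOn_eq {k : ℕ} (hS : G.IsIndepSet (S : Set V)) (hSA : S ⊆ A) (hk : S.card = k)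
    (h : ∀ T ⊆ A, G.IsIndepSet (T : Set V) → T.card ≤ k) : G.alphaOn A = k := by
  obtain ⟨T, hT⟩ := G.exists_isMaxIndepOn A
  have h1 := h T hT.subset hT.indep
  have h2 := hS.card_le_alphaOn hSA
  have := hT.card_eq
  omega

lemma mem_coronaOn : x ∈ G.coronaOn A ↔ ∃ S, G.IsMaxIndepOn A S ∧ x ∈ S := by
  classical
  simp only [coronaOn, Finset.mem_filter, and_iff_right_iff_imp]
  rintro ⟨S, hS, hx⟩
  exact hS.subset hx

lemma mem_coreOn : x ∈ G.coreOn A ↔ ∀ S, G.IsMaxIndepOn A S → x ∈ S := by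
  classical
  simp only [coreOn, Finset.mem_filter, and_iff_right_iff_imp]
  intro h
  obtain ⟨S, hS⟩ := G.exists_isMaxIndepOn A
  exact hS.subset (h S hS)

lemma Matchable.card_le_matchedOn (hT : G.Matchable T) (hTA : T ⊆ A) :
    T.card ≤ G.matchedOn A := by
  classical
  exact Finset.le_sup (f := Finset.card) (by simp [hT, hTA])

lemma exists_matchable (G : SimpleGraph V) (A : Finset V) :
    ∃ T ⊆ A, G.Matchable T ∧ T.card = G.matchedOn A := by
  classical
  obtain ⟨S, hS, h⟩ := Finset.exists_mem_eq_sup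
    (A.powerset.filter fun T => G.Matchable T) ⟨∅, Finset.mem_filter.2 ⟨by simp, id, by simp⟩⟩ Finset.card
  simp only [Finset.mem_filter, Finset.mem_powerset] at hS
  exact ⟨S, hS.1, hS.2, h.symm⟩

/-- The defect of the core and the corona equals the König–Egerváry defect, and is at most one. -/
def CoreCoronaBalanced {V : Type*} (G : SimpleGraph V) (A : Finset V) : Prop :=
  2 * ((G.coronaOn A).card + (G.coreOn A).card) + G.matchedOn A = 2 * A.card + 2 * G.alphaOn A ∧
    ((G.coronaOn A).card + (G.coreOn A).card = 2 * G.alphaOn A ∨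
      (G.coronaOn A).card + (G.coreOn A).card = 2 * G.alphaOn A + 1)

lemma isIndepSet_insert_of_forall_not_adj [DecidableEq V] (hS : G.IsIndepSet (S : Set V))
    (h : ∀ w ∈ S, ¬ G.Adj v w) : G.IsIndepSet ((insert v S : Finset V) : Set V) := by
  rw [Finset.coe_insert]
  refine Set.Pairwise.insert hS fun w hw _ => ⟨h w hw, fun h' => h w hw h'.symm⟩

/-! ### Deleting an isolated vertex. -/

section Isolated

variable [DecidableEq V] (hv : v ∈ A) (hiso : ∀ w ∈ A, ¬ G.Adj v w)
include hv hiso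

lemma alphaOn_of_isolated : G.alphaOn A = G.alphaOn (A.erase v) + 1 := by
  obtain ⟨S, hS⟩ := G.exists_isMaxIndepOn (A.erase v)
  have hvS : v ∉ S := fun h => by simpa using hS.subset h
  have hSA : S ⊆ A := hS.subset.trans (Finset.erase_subset _ _)
  refine alphaOn_eq (S := insert v S)
    (isIndepSet_insert_of_forall_not_adj hS.indep fun w hw => hiso w (hSA hw))
    (Finset.insert_subset hv hSA) (by rw [Finset.card_insert_of_notMem hvS, hS.card_eq]) ?_
  intro T hT hTi
  have h1 : (T.erase v).card ≤ G.alphaOn (A.erase v) :=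
    IsIndepSet.card_le_alphaOn (hTi.mono (by simp)) (Finset.erase_subset_erase _ hT)
  have := Finset.pred_card_le_card_erase (s := T) (a := v)
  omega

lemma IsMaxIndepOn.insert_of_isolated (hS : G.IsMaxIndepOn (A.erase v) S) :
    G.IsMaxIndepOn A (insert v S) := by
  have hvS : v ∉ S := fun h => by simpa using hS.subset h
  have hSA : S ⊆ A := hS.subset.trans (Finset.erase_subset _ _)
  exact ⟨Finset.insert_subset hv hSA,
    isIndepSet_insert_of_forall_not_adj hS.indep fun w hw => hiso w (hSA hw),
    by rw [Finset.card_insert_of_notMem hvS, hS.card_eq, alphaOn_of_isolated hv hiso]⟩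

lemma IsMaxIndepOn.erase_of_isolated (hS : G.IsMaxIndepOn A S) :
    v ∈ S ∧ G.IsMaxIndepOn (A.erase v) (S.erase v) := by
  have hsub := Finset.erase_subset_erase v hS.subset
  have hind : G.IsIndepSet ((S.erase v : Finset V) : Set V) := hS.indep.mono (by simp)
  have h1 := hind.card_le_alphaOn hsub
  have h2 := hS.card_eq
  rw [alphaOn_of_isolated hv hiso] at h2
  have hvS : v ∈ S := by
    by_contra h
    rw [Finset.erase_eq_of_notMem h] at h1
    omega
  refine ⟨hvS, hsub, hind, ?_⟩
  rw [Finset.card_erase_of_mem hvS]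
  omega

lemma coronaOn_of_isolated : G.coronaOn A = insert v (G.coronaOn (A.erase v)) := by
  ext x
  rw [Finset.mem_insert, mem_coronaOn, mem_coronaOn]
  constructor
  · rintro ⟨S, hS, hx⟩
    by_cases h : x = v
    · exact Or.inl h
    · exact Or.inr ⟨_, (hS.erase_of_isolated hv hiso).2, by simp [h, hx]⟩
  · rintro (rfl | ⟨S, hS, hx⟩)
    · obtain ⟨S, hS⟩ := G.exists_isMaxIndepOn A
      exact ⟨S, hS, (hS.erase_of_isolated hv hiso).1⟩
    · exact ⟨_, hS.insert_of_isolated hv hiso, by simp [hx]⟩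

lemma coreOn_of_isolated : G.coreOn A = insert v (G.coreOn (A.erase v)) := by
  ext x
  rw [Finset.mem_insert, mem_coreOn, mem_coreOn]
  constructor
  · intro h
    by_cases hxv : x = v
    · exact Or.inl hxv
    · exact Or.inr fun S hS => by simpa [hxv] using h _ (hS.insert_of_isolated hv hiso)
  · rintro (rfl | h) S hS
    · exact (hS.erase_of_isolated hv hiso).1
    · exact Finset.mem_of_mem_erase (h _ (hS.erase_of_isolated hv hiso).2)

omit hv in
lemma matchedOn_of_isolated : G.matchedOn A = G.matchedOn (A.erase v) := by
  apply le_antisymm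
  · obtain ⟨T, hTA, hT, hc⟩ := G.exists_matchable A
    rw [← hc]
    refine hT.card_le_matchedOn (Finset.subset_erase.2 ⟨hTA, fun hvT => ?_⟩)
    obtain ⟨f, hf⟩ := hT
    exact hiso _ (hTA (hf v hvT).1) (hf v hvT).2.2
  · obtain ⟨T, hTA, hT, hc⟩ := G.exists_matchable (A.erase v)
    rw [← hc]
    exact hT.card_le_matchedOn (hTA.trans (Finset.erase_subset _ _))

lemma CoreCoronaBalanced.of_isolated (h : G.CoreCoronaBalanced (A.erase v)) :
    G.CoreCoronaBalanced A := by
  have h1 : v ∉ G.coronaOn (A.erase v) := fun h => by simp [coronaOn] at h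
  have h2 : v ∉ G.coreOn (A.erase v) := fun h => by simp [coreOn] at h
  have h3 := Finset.card_erase_add_one hv
  unfold CoreCoronaBalanced at h ⊢
  rw [coronaOn_of_isolated hv hiso, coreOn_of_isolated hv hiso, matchedOn_of_isolated hiso,
    alphaOn_of_isolated hv hiso, Finset.card_insert_of_notMem h1, Finset.card_insert_of_notMem h2]
  omega

end Isolated

/-! ### Deleting a pendant vertex v and its neighbour u. -/

section Pendant

variable [DecidableEq V] (hv : v ∈ A) (hvu : G.Adj v u)
  (hpen : ∀ w ∈ A, G.Adj v w → w = u)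
include hv hvu hpen

omit hv hvu in
lemma isIndepSet_insert_of_pendant (hS : G.IsIndepSet (S : Set V))
    (hSA : S ⊆ (A.erase u).erase v) : G.IsIndepSet ((insert v S : Finset V) : Set V) := by
  refine isIndepSet_insert_of_forall_not_adj hS fun w hw h => ?_
  have := hSA hw
  simp only [Finset.mem_erase] at this
  exact this.2.1 (hpen w this.2.2 h)

/-- An independent set contains at most one of the adjacent vertices u and v, while v can be added
to any independent set of the remainder. -/
lemma alphaOn_of_pendant : G.alphaOn A = G.alphaOn ((A.erase u).erase v) + 1 := by
  obtain ⟨S, hS⟩ := G.exists_isMaxIndepOn ((A.erase u).erase v)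
  have hvS : v ∉ S := fun h => by simpa using hS.subset h
  have hSA : S ⊆ A :=
    hS.subset.trans ((Finset.erase_subset _ _).trans (Finset.erase_subset _ _))
  refine alphaOn_eq (S := insert v S)
    (isIndepSet_insert_of_pendant hpen hS.indep hS.subset)
    (Finset.insert_subset hv hSA) (by rw [Finset.card_insert_of_notMem hvS, hS.card_eq]) ?_
  intro T hT hTi
  have h1 : ((T.erase u).erase v).card ≤ G.alphaOn ((A.erase u).erase v) :=
    IsIndepSet.card_le_alphaOn (hTi.mono (fun x hx => by simp at hx; simp [hx]))
      (Finset.erase_subset_erase _ (Finset.erase_subset_erase _ hT))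
  have h2 := Finset.pred_card_le_card_erase (s := T) (a := u)
  have h3 := Finset.pred_card_le_card_erase (s := T.erase u) (a := v)
  by_cases huT : u ∈ T
  · have hvT : v ∉ T.erase u := fun h => hTi (Finset.mem_of_mem_erase h) huT hvu.ne hvu
    rw [Finset.erase_eq_of_notMem hvT] at h1
    omega
  · rw [Finset.erase_eq_of_notMem huT] at h1 h3
    omega

lemma IsMaxIndepOn.insert_of_pendant (hS : G.IsMaxIndepOn ((A.erase u).erase v) S) :
    G.IsMaxIndepOn A (insert v S) := by
  have hvS : v ∉ S := fun h => by simpa using hS.subset h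
  have hSA : S ⊆ A :=
    hS.subset.trans ((Finset.erase_subset _ _).trans (Finset.erase_subset _ _))
  exact ⟨Finset.insert_subset hv hSA,
    isIndepSet_insert_of_pendant hpen hS.indep hS.subset,
    by rw [Finset.card_insert_of_notMem hvS, hS.card_eq, alphaOn_of_pendant hv hvu hpen]⟩

/-- A set meeting {u, v} in no vertex would be an independent set of the remainder, hence one
element too small to be maximum. -/
lemma IsMaxIndepOn.erase_of_pendant (hS : G.IsMaxIndepOn A S) :
    (v ∈ S ↔ u ∉ S) ∧ G.IsMaxIndepOn ((A.erase u).erase v) ((S.erase u).erase v) := by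
  have hsub := Finset.erase_subset_erase v (Finset.erase_subset_erase u hS.subset)
  have hind : G.IsIndepSet (((S.erase u).erase v : Finset V) : Set V) :=
    hS.indep.mono (fun x hx => by simp at hx; simp [hx])
  have h1 := hind.card_le_alphaOn hsub
  have h2 := hS.card_eq
  rw [alphaOn_of_pendant hv hvu hpen] at h2
  by_cases huS : u ∈ S
  · have hvS : v ∉ S := fun h => hS.indep h huS hvu.ne hvu
    refine ⟨by simp [huS, hvS], hsub, hind, ?_⟩
    rw [Finset.erase_eq_of_notMem (a := v) (by simp [hvS]), Finset.card_erase_of_mem huS]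
    omega
  · rw [Finset.erase_eq_of_notMem huS] at h1 hsub hind ⊢
    have hvS : v ∈ S := by
      by_contra h
      rw [Finset.erase_eq_of_notMem h] at h1
      omega
    refine ⟨by simp [huS, hvS], hsub, hind, ?_⟩
    rw [Finset.card_erase_of_mem hvS]
    omega

lemma mem_coronaOn_of_pendant (hxu : x ≠ u) (hxv : x ≠ v) :
    x ∈ G.coronaOn A ↔ x ∈ G.coronaOn ((A.erase u).erase v) := by
  rw [mem_coronaOn, mem_coronaOn]
  constructor
  · rintro ⟨S, hS, hx⟩
    exact ⟨_, (hS.erase_of_pendant hv hvu hpen).2, by simp [*]⟩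
  · rintro ⟨S, hS, hx⟩
    exact ⟨_, hS.insert_of_pendant hv hvu hpen, by simp [hx]⟩

lemma mem_coreOn_of_pendant (_hxu : x ≠ u) (hxv : x ≠ v) :
    x ∈ G.coreOn A ↔ x ∈ G.coreOn ((A.erase u).erase v) := by
  rw [mem_coreOn, mem_coreOn]
  constructor
  · intro h S hS
    simpa [hxv] using h _ (hS.insert_of_pendant hv hvu hpen)
  · intro h S hS
    exact Finset.mem_of_mem_erase (Finset.mem_of_mem_erase
      (h _ (hS.erase_of_pendant hv hvu hpen).2))

/-- Each maximum independent set contains exactly one of u and v, so u is in the corona exactly when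
v is not in the core. If u is in the corona, the corona gains u and v and the core gains nothing;
otherwise corona and core each gain v. The total gain is two either way. -/
lemma card_coronaOn_add_card_coreOn_of_pendant :
    (G.coronaOn A).card + (G.coreOn A).card =
      (G.coronaOn ((A.erase u).erase v)).card + (G.coreOn ((A.erase u).erase v)).card + 2 := by
  obtain ⟨S, hS⟩ := G.exists_isMaxIndepOn ((A.erase u).erase v)
  have hS' := hS.insert_of_pendant hv hvu hpen
  have hv_corona : v ∈ G.coronaOn A := mem_coronaOn.2 ⟨_, hS', by simp⟩
  have hu_core : u ∉ G.coreOn A := fun h =>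
    ((hS'.erase_of_pendant hv hvu hpen).1.1 (by simp)) (mem_coreOn.1 h _ hS')
  have hiff : u ∈ G.coronaOn A ↔ v ∉ G.coreOn A := by
    rw [mem_coronaOn, mem_coreOn]
    push Not
    refine exists_congr fun T => and_congr_right fun hT => ?_
    rw [(hT.erase_of_pendant hv hvu hpen).1, not_not]
  have h1 : v ∉ G.coronaOn ((A.erase u).erase v) := fun h => by simp [coronaOn] at h
  have h2 : v ∉ G.coreOn ((A.erase u).erase v) := fun h => by simp [coreOn] at h
  have h3 : u ∉ G.coronaOn ((A.erase u).erase v) := fun h => by simp [coronaOn] at h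
  have h4 : u ∉ G.coreOn ((A.erase u).erase v) := fun h => by simp [coreOn] at h
  have hcor := fun x => mem_coronaOn_of_pendant (x := x) hv hvu hpen
  have hcore := fun x => mem_coreOn_of_pendant (x := x) hv hvu hpen
  by_cases huc : u ∈ G.coronaOn A
  · have e1 : G.coronaOn A = insert u (insert v (G.coronaOn ((A.erase u).erase v))) := by
      ext x
      by_cases hxu : x = u <;> by_cases hxv : x = v <;> grind
    have e2 : G.coreOn A = G.coreOn ((A.erase u).erase v) := by
      ext x
      by_cases hxu : x = u <;> by_cases hxv : x = v <;> grind
    rw [e1, e2, Finset.card_insert_of_notMem (by simp [h3, hvu.ne.symm]),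
      Finset.card_insert_of_notMem h1]
    omega
  · have e1 : G.coronaOn A = insert v (G.coronaOn ((A.erase u).erase v)) := by
      ext x
      by_cases hxu : x = u <;> by_cases hxv : x = v <;> grind
    have e2 : G.coreOn A = insert v (G.coreOn ((A.erase u).erase v)) := by
      ext x
      by_cases hxu : x = u <;> by_cases hxv : x = v <;> grind
    rw [e1, e2, Finset.card_insert_of_notMem h1, Finset.card_insert_of_notMem h2]
    omega

lemma matchedOn_of_pendant (hu : u ∈ A) : G.matchedOn A = G.matchedOn ((A.erase u).erase v) + 2 := by
  apply le_antisymm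
  · obtain ⟨T, hTA, hT, hc⟩ := G.exists_matchable A
    rw [← hc]
    by_cases huT : u ∈ T
    · obtain ⟨f, hf⟩ := hT
      have hvT : v ∈ T → f u = v := fun h => by
        rw [← hpen _ (hTA (hf v h).1) (hf v h).2.2, (hf v h).2.1]
      -- Dropping u and its partner costs two vertices. It also removes v if v was covered, since
      -- the only possible partner of v is u.
      have hM : G.Matchable ((T.erase u).erase (f u)) := by
        refine ⟨f, fun x hx => ?_⟩
        simp only [Finset.mem_erase] at hx ⊢
        have hx' := hf x hx.2.2
        have hu' := hf u huT
        refine ⟨⟨fun h => ?_, fun h => ?_, hx'.1⟩, hx'.2⟩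
        · exact hx.2.1 (by rw [← hx'.2.1, h, hu'.2.1])
        · exact hx.1 (by rw [← hx'.2.1, h])
      have h1 := hM.card_le_matchedOn (A := (A.erase u).erase v) (fun x hx => by
        simp only [Finset.mem_erase] at hx ⊢
        refine ⟨?_, hx.2.1, hTA hx.2.2⟩
        rintro rfl
        exact hx.1 (hvT hx.2.2).symm)
      have h2 := Finset.pred_card_le_card_erase (s := T) (a := u)
      have h3 := Finset.pred_card_le_card_erase (s := T.erase u) (a := f u)
      omega
    · have hvT : v ∉ T := by
        obtain ⟨f, hf⟩ := hT
        intro h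
        have := hf v h
        rw [hpen _ (hTA this.1) this.2.2] at this
        exact huT this.1
      have := hT.card_le_matchedOn (A := (A.erase u).erase v)
        (Finset.subset_erase.2 ⟨Finset.subset_erase.2 ⟨hTA, huT⟩, hvT⟩)
      omega
  · obtain ⟨T, hTA, hT, hc⟩ := G.exists_matchable ((A.erase u).erase v)
    have hvT : v ∉ T := fun h => by simpa using hTA h
    have huT : u ∉ T := fun h => by simpa using hTA h
    have hTA' : T ⊆ A :=
      hTA.trans ((Finset.erase_subset _ _).trans (Finset.erase_subset _ _))
    obtain ⟨f, hf⟩ := hT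
    have hM : G.Matchable (insert u (insert v T)) := by
      refine ⟨fun x => if x = u then v else if x = v then u else f x, fun x hx => ?_⟩
      have hne := hvu.ne
      simp only [Finset.mem_insert] at hx
      rcases hx with rfl | rfl | hx
      · simp [hne, hvu.symm]
      · simp [hne, hvu]
      · have hxu : x ≠ u := fun h => huT (h ▸ hx)
        have hxv : x ≠ v := fun h => hvT (h ▸ hx)
        have hx' := hf x hx
        have hfu : f x ≠ u := fun h => huT (h ▸ hx'.1)
        have hfv : f x ≠ v := fun h => hvT (h ▸ hx'.1)
        simp [hxu, hxv, hfu, hfv, hx']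
    have := hM.card_le_matchedOn (Finset.insert_subset hu (Finset.insert_subset hv hTA'))
    rw [Finset.card_insert_of_notMem (by simp [huT, hvu.ne.symm]),
      Finset.card_insert_of_notMem hvT] at this
    omega

lemma CoreCoronaBalanced.of_pendant (hu : u ∈ A) (h : G.CoreCoronaBalanced ((A.erase u).erase v)) :
    G.CoreCoronaBalanced A := by
  have h1 := Finset.card_erase_add_one hu
  have h2 := Finset.card_erase_add_one (s := A.erase u) (a := v) (by simp [hvu.ne, hv])
  unfold CoreCoronaBalanced at h ⊢
  rw [card_coronaOn_add_card_coreOn_of_pendant hv hvu hpen,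
    matchedOn_of_pendant hv hvu hpen hu, alphaOn_of_pendant hv hvu hpen]
  omega

end Pendant

/-! ### Cycles indexed by `ZMod n`. -/

section Cycle

variable {n : ℕ} [NeZero n] {f : ZMod n → V}

lemma natCast_zmod_inj {n a b : ℕ} (ha : a < n) (hb : b < n) :
    (a : ZMod n) = b ↔ a = b := by
  rw [ZMod.natCast_eq_natCast_iff', Nat.mod_eq_of_lt ha, Nat.mod_eq_of_lt hb]

/-- The index set of an independent set is disjoint from its translate by 1. -/
lemma IsIndepSet.two_mul_card_le_of_cycle (hf : f.Injective)
    (hadj : ∀ i j, G.Adj (f i) (f j) ↔ j = i + 1 ∨ i = j + 1)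
    (hT : G.IsIndepSet (T : Set V)) (hTf : (T : Set V) ⊆ Set.range f) : 2 * T.card ≤ n := by
  classical
  set U : Finset (ZMod n) := Finset.univ.filter fun i => f i ∈ T with hU
  have hUT : U.image f = T := by
    ext x
    simp only [hU, Finset.mem_image, Finset.mem_filter, Finset.mem_univ, true_and]
    constructor
    · rintro ⟨i, hi, rfl⟩
      exact hi
    · intro hx
      obtain ⟨i, rfl⟩ := hTf hx
      exact ⟨i, hx, rfl⟩
  have hdisj : Disjoint U (U.image (· + 1)) := by
    rw [Finset.disjoint_left]
    intro i hi hi'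
    obtain ⟨j, hj, rfl⟩ := Finset.mem_image.1 hi'
    have h := (hadj j (j + 1)).2 (Or.inl rfl)
    exact hT (Finset.mem_filter.1 hj).2 (Finset.mem_filter.1 hi).2 h.ne h
  have h1 := Finset.card_le_univ (U ∪ U.image (· + 1))
  rw [Finset.card_union_of_disjoint hdisj, Finset.card_image_of_injective _ (add_left_injective 1),
    ZMod.card] at h1
  rw [← hUT, Finset.card_image_of_injective _ hf]
  omega

open scoped Classical in
/-- Every second vertex of a cycle, starting at `f t`. -/
noncomputable def alternateVertices (f : ZMod n → V) (t : ZMod n) : Finset V :=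
  (Finset.range (n / 2)).image fun i => f (t + (2 * i : ℕ))

omit [NeZero n] in
lemma card_alternateVertices (hf : f.Injective) (t : ZMod n) :
    (alternateVertices f t).card = n / 2 := by
  classical
  rw [alternateVertices, Finset.card_image_of_injOn, Finset.card_range]
  intro i hi j hj hij
  simp only [Finset.coe_range, Set.mem_Iio] at hi hj
  have := (natCast_zmod_inj (by omega) (by omega)).1 (add_left_cancel (hf hij))
  omega

omit [NeZero n] in
lemma isIndepSet_alternateVertices (hadj : ∀ i j, G.Adj (f i) (f j) ↔ j = i + 1 ∨ i = j + 1)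
    (t : ZMod n) : G.IsIndepSet (alternateVertices f t : Set V) := by
  classical
  -- Both 2i and 2j + 1 are below n, so there is no wraparound and parity separates them, even when
  -- n is odd.
  have key : ∀ i < n / 2, ∀ j < n / 2, t + (2 * i : ℕ) ≠ t + (2 * j : ℕ) + 1 := by
    intro i hi j hj h
    rw [add_assoc] at h
    have h' : ((2 * i : ℕ) : ZMod n) = ((2 * j + 1 : ℕ) : ZMod n) := by
      rw [add_left_cancel h]
      push_cast
      ring
    have := (natCast_zmod_inj (by omega) (by omega)).1 h'
    omega
  intro x hx y hy _ hxy
  simp only [alternateVertices, Finset.coe_image, Finset.coe_range, Set.mem_image,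
    Set.mem_Iio] at hx hy
  obtain ⟨i, hi, rfl⟩ := hx
  obtain ⟨j, hj, rfl⟩ := hy
  rcases (hadj _ _).1 hxy with h | h
  · exact key j hj i hi h
  · exact key i hi j hj h

omit [NeZero n] in
lemma matchable_cycle (hf : f.Injective)
    (hadj : ∀ i j, G.Adj (f i) (f j) ↔ j = i + 1 ∨ i = j + 1) :
    ∃ T : Finset V, (T : Set V) ⊆ Set.range f ∧ G.Matchable T ∧ T.card = 2 * (n / 2) := by
  classical
  have hg := Function.leftInverse_invFun hf
  refine ⟨(Finset.range (2 * (n / 2))).image fun i => f (i : ℕ), ?_, ?_, ?_⟩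
  · intro x hx
    simp only [Finset.coe_image, Set.mem_image] at hx
    obtain ⟨i, -, rfl⟩ := hx
    exact ⟨_, rfl⟩
  -- Index 2i is paired with 2i + 1; for odd n the last index n − 1 stays uncovered.
  · set F : V → V := fun x => if Even (Function.invFun f x).val
      then f (Function.invFun f x + 1) else f (Function.invFun f x - 1) with hF
    have heven : ∀ i, 2 * i < n → F (f (2 * i : ℕ)) = f (2 * i + 1 : ℕ) := by
      intro i hi
      simp only [hF, hg _, ZMod.val_cast_of_lt hi]
      simp
    have hodd : ∀ i, 2 * i + 1 < n → F (f (2 * i + 1 : ℕ)) = f (2 * i : ℕ) := by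
      intro i hi
      simp only [hF, hg _, ZMod.val_cast_of_lt hi]
      simp
    refine ⟨F, fun x hx => ?_⟩
    simp only [Finset.mem_image, Finset.mem_range] at hx ⊢
    obtain ⟨m, hm, rfl⟩ := hx
    obtain ⟨i, rfl | rfl⟩ := m.even_or_odd'
    · rw [heven i (by omega), hodd i (by omega)]
      exact ⟨⟨2 * i + 1, by omega, rfl⟩, rfl, (hadj _ _).2 (Or.inl (by push_cast; rfl))⟩
    · rw [hodd i (by omega), heven i (by omega)]
      exact ⟨⟨2 * i, by omega, rfl⟩, rfl, (hadj _ _).2 (Or.inr (by push_cast; rfl))⟩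
  · rw [Finset.card_image_of_injOn, Finset.card_range]
    intro i hi j hj hij
    simp only [Finset.coe_range, Set.mem_Iio] at hi hj
    exact (natCast_zmod_inj (by omega) (by omega)).1 (hf hij)

/-- The partner map is a fixed-point-free involution, so the ones over T cancel in pairs modulo 2.
-/
lemma Matchable.even_card (hT : G.Matchable T) : Even T.card := by
  classical
  obtain ⟨f, hf⟩ := hT
  rw [← Nat.not_odd_iff_even]
  intro hodd
  have := Finset.sum_involution (s := T) (f := fun _ => (1 : ZMod 2)) (fun x _ => f x)
    (fun _ _ => by decide) (fun x hx _ => (hf x hx).2.2.ne.symm) (fun x hx => (hf x hx).1)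
    (fun x hx => (hf x hx).2.1)
  simp only [Finset.sum_const, nsmul_eq_mul, mul_one] at this
  rw [ZMod.natCast_eq_zero_iff_even] at this
  exact Nat.not_even_iff_odd.2 hodd this

/-- Rotations of the alternating set are all maximum. The one starting at t contains `f t`, so the
corona is everything; the one starting at t + 1 omits `f t`, so the core is empty. -/
lemma CoreCoronaBalanced.of_cycle (hn : 2 ≤ n) (hf : f.Injective)
    (hA : (A : Set V) = Set.range f)
    (hadj : ∀ i j, G.Adj (f i) (f j) ↔ j = i + 1 ∨ i = j + 1) : G.CoreCoronaBalanced A := by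
  classical
  have hsub : ∀ t, alternateVertices f t ⊆ A := by
    intro t x hx
    rw [← Finset.mem_coe, hA]
    obtain ⟨i, -, rfl⟩ := Finset.mem_image.1 hx
    exact ⟨_, rfl⟩
  have hle : ∀ T ⊆ A, G.IsIndepSet (T : Set V) → T.card ≤ n / 2 := by
    intro T hT hTi
    have := hTi.two_mul_card_le_of_cycle hf hadj (hA ▸ Finset.coe_subset.2 hT)
    omega
  have halpha : G.alphaOn A = n / 2 :=
    alphaOn_eq (isIndepSet_alternateVertices hadj 0) (hsub 0) (card_alternateVertices hf 0) hle
  have hmax : ∀ t, G.IsMaxIndepOn A (alternateVertices f t) := fun t =>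
    ⟨hsub t, isIndepSet_alternateVertices hadj t, by rw [card_alternateVertices hf, halpha]⟩
  have hmem : ∀ t, f t ∈ alternateVertices f t := fun t =>
    Finset.mem_image.2 ⟨0, Finset.mem_range.2 (by omega), by simp⟩
  have hcard : A.card = n := by
    have : A = Finset.univ.image f := by
      rw [← Finset.coe_inj, hA]
      simp
    rw [this, Finset.card_image_of_injective _ hf, Finset.card_univ, ZMod.card]
  have hcorona : G.coronaOn A = A := by
    refine (Finset.filter_subset _ _).antisymm fun x hx => ?_
    rw [← Finset.mem_coe, hA] at hx
    obtain ⟨t, rfl⟩ := hx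
    exact mem_coronaOn.2 ⟨_, hmax t, hmem t⟩
  have hcore : G.coreOn A = ∅ := by
    refine Finset.eq_empty_of_forall_notMem fun x hx => ?_
    rw [mem_coreOn] at hx
    have hxA := hsub 0 (hx _ (hmax 0))
    rw [← Finset.mem_coe, hA] at hxA
    obtain ⟨t, rfl⟩ := hxA
    have h := (hadj t (t + 1)).2 (Or.inl rfl)
    exact (hmax (t + 1)).indep (hx _ (hmax _)) (hmem _) h.ne h
  have hmatched : G.matchedOn A = 2 * (n / 2) := by
    apply le_antisymm
    · obtain ⟨T, hTA, hT, hc⟩ := G.exists_matchable A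
      obtain ⟨k, hk⟩ := hT.even_card
      have := Finset.card_le_card hTA
      omega
    · obtain ⟨T, hTf, hT, hc⟩ := matchable_cycle hf hadj
      rw [← hc]
      exact hT.card_le_matchedOn (by rwa [← Finset.coe_subset, hA])
  unfold CoreCoronaBalanced
  rw [hcorona, hcore, halpha, hmatched, hcard, Finset.card_empty]
  omega

end Cycle

/-! ### Structure of graphs with at most one cycle. -/

/-- A forest extends to a spanning tree of the complete graph. -/
lemma IsAcyclic.card_edgeFinset_lt [Fintype V] [Nonempty V] [Fintype G.edgeSet]
    (h : G.IsAcyclic) : G.edgeFinset.card < Fintype.card V := by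
  classical
  obtain ⟨F, hGF, -, hF⟩ :=
    (connected_top (V := V)).exists_isTree_le_of_le_of_isAcyclic le_top h
  have h1 := hF.card_edgeFinset
  have h2 := Finset.card_le_card (edgeFinset_subset_edgeFinset.2 hGF)
  omega

lemma Subgraph.map_injective_of_injective {W : Type*} {G' : SimpleGraph W} {f : G →g G'}
    (hf : Function.Injective f) : Function.Injective (Subgraph.map f) := by
  intro C C' h
  ext x y
  · rw [← hf.mem_set_image, ← hf.mem_set_image (s := C'.verts)]
    exact iff_of_eq (congrArg (fun D => f x ∈ D.verts) h)
  · have := congrArg (fun D => D.Adj (f x) (f y)) h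
    simpa [Subgraph.map, Relation.map_apply_apply hf hf] using this

/-- Any two cycles of the graph agree as subgraphs. -/
def AtMostOneCycle (G : SimpleGraph V) : Prop :=
  ∀ C C' : G.Subgraph, C.IsCycleSubgraph → C'.IsCycleSubgraph → C = C'

lemma AtMostOneCycle.induce (h : G.AtMostOneCycle) (s : Set V) :
    (G.induce s).AtMostOneCycle := by
  rintro C C' ⟨u, p, hp, rfl⟩ ⟨u', p', hp', rfl⟩
  have hinj : Function.Injective (Embedding.induce (G := G) s).toHom :=
    (Embedding.induce (G := G) s).injective
  refine Subgraph.map_injective_of_injective hinj ?_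
  have := h _ _ ⟨_, p.map (Embedding.induce s).toHom, hp.map hinj, rfl⟩
    ⟨_, p'.map (Embedding.induce s).toHom, hp'.map hinj, rfl⟩
  simpa only [Walk.toSubgraph_map] using this

lemma AtMostOneCycle.exists_isAcyclic_deleteEdges [Nonempty V] (h : G.AtMostOneCycle) :
    ∃ e, (G.deleteEdges {e}).IsAcyclic := by
  by_cases hG : G.IsAcyclic
  · obtain ⟨x⟩ := ‹Nonempty V›
    -- The diagonal pair is not an edge, so nothing is deleted from a graph that is already acyclic.
    exact ⟨s(x, x), hG.anti (G.deleteEdges_le _)⟩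
  · unfold IsAcyclic at hG
    push Not at hG
    obtain ⟨u, p, hp⟩ := hG
    obtain ⟨e, he⟩ := List.exists_mem_of_ne_nil p.edges (by
      rw [← List.length_pos_iff, Walk.length_edges]
      have := hp.three_le_length
      omega)
    -- A cycle surviving the deletion would equal p as a subgraph, hence contain the deleted edge e.
    refine ⟨e, fun v q hq => ?_⟩
    have h1 := h _ _ ⟨_, p, hp, rfl⟩ ⟨_, q.mapLe (G.deleteEdges_le _), hq.mapLe _, rfl⟩
    rw [← Walk.mem_edges_toSubgraph, h1, Walk.mem_edges_toSubgraph, Walk.edges_mapLe_eq_edges] at he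
    simpa using q.edges_subset_edgeSet he

/-- Deleting one edge leaves a forest, so there are at most |V| edges and the degree sum is at most
2|V|, which forces equality at every vertex. -/
lemma AtMostOneCycle.degree_eq_two [Fintype V] [Nonempty V] [DecidableRel G.Adj]
    (h : G.AtMostOneCycle) (hdeg : ∀ v, 2 ≤ G.degree v) : ∀ v, G.degree v = 2 := by
  classical
  obtain ⟨e, he⟩ := h.exists_isAcyclic_deleteEdges
  have h1 := he.card_edgeFinset_lt
  have h2 : G.edgeFinset.card ≤ (G.deleteEdges {e}).edgeFinset.card + 1 := by
    have : G.edgeFinset ⊆ insert e (G.deleteEdges {e}).edgeFinset := by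
      intro x hx
      by_cases hxe : x = e <;> simp_all
    exact (Finset.card_le_card this).trans (Finset.card_insert_le _ _)
  have h3 := G.sum_degrees_eq_twice_card_edges
  have h4 : ∑ _v : V, 2 = ∑ v, G.degree v := by
    refine le_antisymm (Finset.sum_le_sum fun v _ => hdeg v) ?_
    rw [Finset.sum_const, Finset.card_univ, smul_eq_mul]
    omega
  rw [Finset.sum_eq_sum_iff_of_le fun v _ => hdeg v] at h4
  exact fun v => (h4 v (Finset.mem_univ v)).symm

/-- In a 2-regular graph every vertex lies on a cycle filling its component; since all these cycles
coincide, a single one visits every vertex. -/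
lemma AtMostOneCycle.exists_isCycle_verts_eq_univ [Fintype V] [Nonempty V] [DecidableRel G.Adj]
    (h : G.AtMostOneCycle) (hdeg : ∀ v, 2 ≤ G.degree v) :
    ∃ (u : V) (p : G.Walk u u), p.IsCycle ∧ (∀ v, v ∈ p.support) ∧
      ∀ v w, p.toSubgraph.Adj v w ↔ G.Adj v w := by
  have hdeg' := h.degree_eq_two hdeg
  have hcyc : G.IsCycles := fun v _ => by
    rw [Set.ncard_eq_toFinset_card', Set.toFinset_card, card_neighborSet_eq_degree, hdeg']
  have key : ∀ v, ∃ p : G.Walk v v, p.IsCycle ∧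
      p.toSubgraph.verts = (G.connectedComponentMk v).supp := fun v => by
    refine hcyc.exists_cycle_toSubgraph_verts_eq_connectedComponentSupp rfl ?_
    obtain ⟨w, hw⟩ := (G.degree_pos_iff_exists_adj v).1 (by rw [hdeg']; norm_num)
    exact ⟨w, hw⟩
  obtain ⟨u⟩ := ‹Nonempty V›
  obtain ⟨p, hp, -⟩ := key u
  have hsupp : ∀ v, v ∈ p.support := by
    intro v
    obtain ⟨q, hq, -⟩ := key v
    rw [← Walk.mem_verts_toSubgraph, h _ _ ⟨_, p, hp, rfl⟩ ⟨_, q, hq, rfl⟩]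
    simp
  exact ⟨u, p, hp, hsupp, fun v w => hp.adj_toSubgraph_iff_of_isCycles hcyc (by simp [hsupp]) w⟩

lemma Walk.IsCycle.exists_zmod_parametrization {p : G.Walk u u} (hp : p.IsCycle) :
    ∃ f : ZMod p.length → V, f.Injective ∧ Set.range f = p.toSubgraph.verts ∧
      ∀ i j, p.toSubgraph.Adj (f i) (f j) ↔ j = i + 1 ∨ i = j + 1 := by
  have hlen := hp.three_le_length
  have : NeZero p.length := ⟨by omega⟩
  set f : ZMod p.length → V := fun i => p.getVert i.val with hf
  have hinj : f.Injective := fun i j hij => by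
    refine ZMod.val_injective _ (hp.getVert_injOn' ?_ ?_ hij)
    · have := i.val_lt
      simp only [Set.mem_ofPred_eq]
      omega
    · have := j.val_lt
      simp only [Set.mem_ofPred_eq]
      omega
  -- The endpoint m = `p.length` is included: it casts to 0, and the walk is closed. This handles
  -- the edge that wraps around.
  have hcast : ∀ m ≤ p.length, f m = p.getVert m := by
    intro m hm
    rcases hm.lt_or_eq with hm | rfl
    · simp only [hf, ZMod.val_cast_of_lt hm]
    · simp [hf]
  have hadj : ∀ i, p.toSubgraph.Adj (f i) (f (i + 1)) := by
    intro i
    have := p.toSubgraph_adj_getVert i.val_lt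
    rwa [← hcast _ i.val_lt.le, ← hcast _ i.val_lt, Nat.cast_succ, ZMod.natCast_zmod_val] at this
  refine ⟨f, hinj, ?_, fun i j => ⟨fun h => ?_, ?_⟩⟩
  · ext x
    rw [Walk.mem_verts_toSubgraph, Walk.mem_support_iff_exists_getVert]
    constructor
    · rintro ⟨i, rfl⟩
      exact ⟨i.val, rfl, i.val_lt.le⟩
    · rintro ⟨m, rfl, hm⟩
      exact ⟨m, hcast m hm⟩
  · obtain ⟨m, hm, hml⟩ := p.toSubgraph_adj_iff.1 h
    rw [← hcast _ hml.le, ← hcast _ hml, Nat.cast_succ, Sym2.eq_iff] at hm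
    rcases hm with ⟨h1, h2⟩ | ⟨h1, h2⟩
    · left
      rw [← hinj h1, ← hinj h2]
    · right
      rw [← hinj h1, ← hinj h2]
  · rintro (rfl | rfl)
    · exact hadj i
    · exact (hadj j).symm

/-- Strong induction on A: the two reductions apply until the induced subgraph is empty or has
minimum degree at least 2, and in the latter case it is a cycle. -/
lemma AtMostOneCycle.coreCoronaBalanced (h : G.AtMostOneCycle) (A : Finset V) :
    G.CoreCoronaBalanced A := by
  classical
  induction A using Finset.strongInduction with
  | H A ih =>
  by_cases hiso : ∃ v ∈ A, ∀ w ∈ A, ¬ G.Adj v w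
  · obtain ⟨v, hv, hiso⟩ := hiso
    exact (ih _ (Finset.erase_ssubset hv)).of_isolated hv hiso
  by_cases hpen : ∃ v ∈ A, ∃ u ∈ A, G.Adj v u ∧ ∀ w ∈ A, G.Adj v w → w = u
  · obtain ⟨v, hv, u, hu, hvu, hpen⟩ := hpen
    exact (ih _ ((Finset.erase_subset _ _).trans_ssubset
      (Finset.erase_ssubset hu))).of_pendant hv hvu hpen hu
  push Not at hiso hpen
  rcases A.eq_empty_or_nonempty with rfl | ⟨a, ha⟩
  · have halpha : G.alphaOn ∅ = 0 :=
      alphaOn_eq (S := ∅) (by simp) le_rfl rfl fun T hT _ => by simp [Finset.subset_empty.1 hT]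
    have hmatched : G.matchedOn ∅ = 0 := by
      obtain ⟨T, hT, -, hc⟩ := G.exists_matchable ∅
      rw [← hc, Finset.subset_empty.1 hT, Finset.card_empty]
    simp [CoreCoronaBalanced, halpha, hmatched, coronaOn, coreOn]
  · have : Nonempty (A : Set V) := ⟨⟨a, ha⟩⟩
    obtain ⟨u, p, hp, hsupp, hadj⟩ :=
      (h.induce (A : Set V)).exists_isCycle_verts_eq_univ (fun v => by
        obtain ⟨w, hw, hvw⟩ := hiso v v.2
        obtain ⟨w', hw', hvw', hne⟩ := hpen v v.2 w hw hvw
        rw [← card_neighborFinset_eq_degree, Nat.succ_le_iff, Finset.one_lt_card]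
        exact ⟨⟨w, hw⟩, by simpa using hvw, ⟨w', hw'⟩, by simpa using hvw',
          fun h => hne (Subtype.ext_iff.1 h).symm⟩)
    obtain ⟨f, hf, hrange, hfadj⟩ := hp.exists_zmod_parametrization
    have hlen := hp.three_le_length
    have : NeZero p.length := ⟨by omega⟩
    refine CoreCoronaBalanced.of_cycle (f := fun i => (f i : V)) (by omega)
      (Subtype.val_injective.comp hf) ?_ fun i j => ?_
    · have hr : Set.range f = Set.univ := by
        rw [hrange]
        ext v
        simp [hsupp]
      rw [← Function.comp_def, Set.range_comp, hr]
      simp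
    · rw [← hfadj, hadj]
      rfl

/-! ### Translation to matchings, core and corona of the whole graph. -/

lemma Subgraph.IsMatching.two_mul_ncard_edgeSet [Fintype V] {M : G.Subgraph} (hM : M.IsMatching) :
    2 * M.edgeSet.ncard = M.verts.ncard := by
  classical
  have h := M.spanningCoe.sum_degrees_eq_twice_card_edges
  have h1 : ∀ v, M.spanningCoe.degree v = if v ∈ M.verts then 1 else 0 := by
    intro v
    split_ifs with hv
    · obtain ⟨w, hw, huniq⟩ := hM hv
      rw [← card_neighborFinset_eq_degree, Finset.card_eq_one]
      exact ⟨w, by ext x; simpa using ⟨huniq x, fun h => h ▸ hw⟩⟩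
    · rw [← card_neighborFinset_eq_degree, Finset.card_eq_zero]
      ext x
      simpa using fun h => hv (M.edge_vert h)
  simp only [h1, Finset.sum_boole, Nat.cast_id] at h
  rw [← coe_edgeFinset M.spanningCoe |>.trans M.edgeSet_spanningCoe, Set.ncard_coe_finset, ← h,
    ← Set.ncard_coe_finset]
  simp

lemma exists_isMatching_iff_matchable [Finite V] (T : Finset V) :
    (∃ M : G.Subgraph, M.IsMatching ∧ M.verts = T) ↔ G.Matchable T := by
  classical
  constructor
  · rintro ⟨M, hM, hT⟩
    have hex : ∀ x : V, ∃ y, x ∈ T → M.Adj x y := fun x => by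
      by_cases hx : x ∈ T
      · obtain ⟨y, hy, -⟩ := hM (hT ▸ Finset.mem_coe.2 hx)
        exact ⟨y, fun _ => hy⟩
      · exact ⟨x, fun h => absurd h hx⟩
    choose f hf using hex
    have hmem : ∀ x ∈ T, f x ∈ T := fun x hx => by
      rw [← Finset.mem_coe, ← hT]
      exact M.edge_vert (hf x hx).symm
    exact ⟨f, fun x hx => ⟨hmem x hx,
      hM.eq_of_adj_left (hf _ (hmem x hx)) (hf x hx).symm, (hf x hx).adj_sub⟩⟩
  · intro ⟨f, hf⟩
    let M : G.Subgraph :=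
      { verts := T
        Adj := fun x y => x ∈ T ∧ f x = y
        adj_sub := by
          rintro x y ⟨hx, rfl⟩
          exact (hf x hx).2.2
        edge_vert := fun h => h.1
        symm := ⟨by
          rintro x y ⟨hx, rfl⟩
          exact ⟨(hf x hx).1, (hf x hx).2.1⟩⟩ }
    refine ⟨M, fun x hx => ?_, rfl⟩
    exact ⟨f x, ⟨hx, rfl⟩, fun y hy => hy.2.symm⟩

lemma two_mul_matchingNum [Fintype V] : 2 * G.matchingNum = G.matchedOn Finset.univ := by
  classical
  have hbdd : ∀ n ∈ {n | ∃ M : G.Subgraph, M.IsMatching ∧ M.edgeSet.ncard = n},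
      2 * n ≤ G.matchedOn Finset.univ := by
    rintro n ⟨M, hM, rfl⟩
    rw [Subgraph.IsMatching.two_mul_ncard_edgeSet hM, Set.ncard_eq_toFinset_card']
    exact ((exists_isMatching_iff_matchable _).1 ⟨M, hM, by simp⟩).card_le_matchedOn
      (Finset.subset_univ _)
  -- `sSup` on `ℕ` defaults to 0 for unbounded sets; boundedness, together with the empty matching,
  -- ensures that it is attained.
  have hbdd' : BddAbove {n | ∃ M : G.Subgraph, M.IsMatching ∧ M.edgeSet.ncard = n} :=
    ⟨G.matchedOn Finset.univ, fun n hn => by have := hbdd n hn; omega⟩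
  apply le_antisymm
  · exact hbdd _ (Nat.sSup_mem ⟨0, ⊥, by simp [Subgraph.IsMatching], by simp⟩ hbdd')
  · obtain ⟨T, -, hT, hc⟩ := G.exists_matchable Finset.univ
    obtain ⟨M, hM, hMT⟩ := (exists_isMatching_iff_matchable T).2 hT
    have h1 := Subgraph.IsMatching.two_mul_ncard_edgeSet hM
    rw [hMT, Set.ncard_coe_finset, hc] at h1
    rw [← h1]
    exact Nat.mul_le_mul_left 2 (le_csSup hbdd' ⟨M, hM, rfl⟩)

lemma isMaxIndepOn_univ [Fintype V] :
    G.IsMaxIndepOn Finset.univ S ↔ G.IsMaximumIndepSet S := by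
  constructor
  · intro h
    refine ⟨h.indep, fun T hT => ?_⟩
    rw [h.card_eq]
    exact hT.card_le_alphaOn (Finset.subset_univ _)
  · intro h
    obtain ⟨T, hT⟩ := G.exists_isMaxIndepOn Finset.univ
    refine ⟨Finset.subset_univ _, h.1, le_antisymm (h.1.card_le_alphaOn (Finset.subset_univ _)) ?_⟩
    rw [← hT.card_eq]
    exact h.2 T hT.indep

lemma alphaOn_univ [Fintype V] : G.alphaOn Finset.univ = G.indepNum := by
  obtain ⟨T, hT⟩ := G.exists_isMaxIndepOn Finset.univ
  rw [← hT.card_eq, maximumIndepSet_card_eq_indepNum T (isMaxIndepOn_univ.1 hT)]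

lemma coe_coronaOn_univ [Fintype V] : (G.coronaOn Finset.univ : Set V) = G.corona := by
  ext x
  simp [corona, mem_coronaOn, isMaxIndepOn_univ]

lemma coe_coreOn_univ [Fintype V] : (G.coreOn Finset.univ : Set V) = G.core := by
  ext x
  simp [core, mem_coreOn, isMaxIndepOn_univ]

end SimpleGraph

theorem mainTheorem2 {V : Type*} [Finite V] (G : SimpleGraph V) (hG : G.IsUnicyclic) :
    (2 * G.indepNum ≤ G.corona.ncard + G.core.ncard ∧
      G.corona.ncard + G.core.ncard ≤ 2 * G.indepNum + 1) ∧
    (¬ G.IsKonigEgervary ↔ G.corona.ncard + G.core.ncard = 2 * G.indepNum + 1) := by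
  have := Fintype.ofFinite V
  have hcyc : G.AtMostOneCycle := fun C C' h h' => hG.2.unique h h'
  have h := hcyc.coreCoronaBalanced Finset.univ
  unfold SimpleGraph.CoreCoronaBalanced at h
  rw [← Set.ncard_coe_finset, ← Set.ncard_coe_finset (G.coreOn _), G.coe_coronaOn_univ,
    G.coe_coreOn_univ, G.alphaOn_univ, ← G.two_mul_matchingNum, Finset.card_univ,
    ← Nat.card_eq_fintype_card] at h
  unfold SimpleGraph.IsKonigEgervary
  -- After halving, `h` says |corona| + |core| − 2α = |V| − α − μ with value 0 or 1; the graph is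
  -- König–Egerváry exactly when this value is 0.
  omega
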